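/- Let $K$ be a field and let $E=(E^0,E^1,r,s)$ be a directed graph with at least one vertex, where the sets $E^0$ (vertices) and $E^1$ (edges) may have arbitrary cardinality and $r,s:E^1\to E^0$ are the range and source maps. A path is a finite sequence of edges $e_1\cdots e_n$ with $r(e_i)=s(e_{i+1})$ for $1\le i<n$; it goes from $s(e_1)$ to $r(e_n)$. Each vertex $v$ is also regarded as a path of length $0$ from $v$ to $v$. Write $u\ge v$ if there is a path from $u$ to $v$. A cycle is a path $e_1\cdots e_n$ with $n\ge 1$, $r(e_n)=s(e_1)$ and $s(e_i)\ne s(e_j)$ for $i\neq j$; an exit for it is an edge $e$ such that $s(e)=s(e_i)$ and $e\ne e_i$ for some $i$. The Leavitt path algebra $L_K(E)$ is the associative, not necessarily unital, $K$-algebra generated by the elements $v$ ($v\in E^0$) and $e,e^*$ ($e\in E^1$) subject to the relations: $vw=\delta_{v,w}v$ for all $v,w\in E^0$; $s(e)e=er(e)=e$ and $r(e)e^*=e^*s(e)=e^*$ for all $e\in E^1$; $e^*f=\delta_{e,f}\,r(e)$ for all $e,f\in E^1$; and $v=\sum_{s(e)=v}ee^*$ for every vertex $v$ with $1\le|s^{-1}(v)|<\infty$.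 Suppose that 1. (Condition (MT3)) for all $v,w\in E^0$ there is $u\in E^0$ with $v\ge u$ and $w\ge u$; 2. (Condition (L)) every cycle in $E$ has an exit; 3. (Countable Separation Property of $E^0$) there is an at most countable set $C\subseteq E^0$ such that for every $w\in E^0$ there is $v\in C$ with $w\ge v$. Then $L_K(E)$ is primitive, both as a left and as a right primitive ring: it has a faithful simple left module and a faithful simple right module. (A left module $M$ over a possibly nonunital ring $R$ is simple if $RM\ne 0$ and its only submodules are $0$ and $M$; it is faithful if $a\in R$ and $aM=0$ imply $a=0$. Similarly for right modules.) -/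

import Mathlib

universe u v w

set_option linter.checkUnivs false

/-- A directed graph `E = (E⁰, E¹, r, s)`: two sets of arbitrary cardinality (vertices and edges)
and two functions from edges to vertices (source and range). -/
structure DirGraph where
  /-- The set `E⁰` of vertices. -/
  Vertex : Type u
  /-- The set `E¹` of edges. -/
  Edge : Type v
  /-- The source map `s`. -/
  s : Edge → Vertex
  /-- The range map `r`. -/
  r : Edge → Vertex

namespace DirGraph

/-- `E.IsPath a p b`: the finite sequence of edges `p = e₁ ⋯ eₙ` satisfies `r(eᵢ) = s(eᵢ₊₁)`, and is
thus a path, with source `a` and range `b`. The empty sequence is the path of length `0` at a vertex,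
with that vertex as source and range. -/
inductive IsPath (E : DirGraph.{u, v}) : E.Vertex → List E.Edge → E.Vertex → Prop
  | nil (a : E.Vertex) : IsPath E a [] a
  | cons (e : E.Edge) {p : List E.Edge} {b : E.Vertex} (h : IsPath E (E.r e) p b) :
      IsPath E (E.s e) (e :: p) b

/-- The relation `a ≥ b` on vertices: there is a path (possibly of length `0`) from `a` to `b`. -/
def Connects (E : DirGraph.{u, v}) (a b : E.Vertex) : Prop :=
  ∃ p : List E.Edge, E.IsPath a p b

/-- `p = e₁ ⋯ eₙ` (`n ≥ 1`) is a cycle based at `a`: a path from `a` to `a` with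
`s(eᵢ) ≠ s(eⱼ)` for all `i ≠ j`. -/
def IsCycle (E : DirGraph.{u, v}) (a : E.Vertex) (p : List E.Edge) : Prop :=
  p ≠ [] ∧ E.IsPath a p a ∧ (p.map E.s).Nodup

/-- The edge `e` is an exit for `p = e₁ ⋯ eₙ`: for some `i`, `s(e) = s(eᵢ)` and `e ≠ eᵢ`. -/
def IsExit (E : DirGraph.{u, v}) (e : E.Edge) (p : List E.Edge) : Prop :=
  ∃ f ∈ p, E.s e = E.s f ∧ e ≠ f

/-- Condition (MT3). -/
def ConditionMT3 (E : DirGraph.{u, v}) : Prop :=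
  ∀ a b : E.Vertex, ∃ c : E.Vertex, E.Connects a c ∧ E.Connects b c

/-- Condition (L): every cycle has an exit. -/
def ConditionL (E : DirGraph.{u, v}) : Prop :=
  ∀ (a : E.Vertex) (p : List E.Edge), E.IsCycle a p → ∃ e : E.Edge, E.IsExit e p

/-- The Countable Separation Property of a set `S` of vertices. -/
def HasCSP (E : DirGraph.{u, v}) (S : Set E.Vertex) : Prop :=
  ∃ C : Set E.Vertex, C.Countable ∧ ∀ a ∈ S, ∃ b ∈ C, E.Connects a b

/-- The generators `v`, `e`, `e*` of the Leavitt path algebra. -/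
inductive Gen (E : DirGraph.{u, v}) : Type (max u v)
  | vertex (a : E.Vertex) : Gen E
  | edge (e : E.Edge) : Gen E
  | ghost (e : E.Edge) : Gen E

/-- The free associative, not necessarily unital, `K`-algebra on the generators: the semigroup
algebra of the free semigroup of nonempty words. -/
abbrev FreeAlg (K : Type w) [Field K] (E : DirGraph.{u, v}) : Type (max u v w) :=
  MonoidAlgebra K (FreeSemigroup (Gen E))

/-- A generator as an element of the free algebra. -/
noncomputable def gen (K : Type w) [Field K] {E : DirGraph.{u, v}} (x : Gen E) : FreeAlg K E :=
  MonoidAlgebra.single (FreeSemigroup.of x) 1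

open Gen in
/-- The defining relations of the Leavitt path algebra. -/
inductive Rel (K : Type w) [Field K] (E : DirGraph.{u, v}) : FreeAlg K E → FreeAlg K E → Prop
  -- (V)
  | vertex_mul_self (a : E.Vertex) :
      Rel K E (gen K (vertex a) * gen K (vertex a)) (gen K (vertex a))
  | vertex_mul_of_ne (a b : E.Vertex) (h : a ≠ b) :
      Rel K E (gen K (vertex a) * gen K (vertex b)) 0
  -- (E1)
  | source_mul_edge (e : E.Edge) :
      Rel K E (gen K (vertex (E.s e)) * gen K (edge e)) (gen K (edge e))
  | edge_mul_range (e : E.Edge) :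
      Rel K E (gen K (edge e) * gen K (vertex (E.r e))) (gen K (edge e))
  -- (E2)
  | range_mul_ghost (e : E.Edge) :
      Rel K E (gen K (vertex (E.r e)) * gen K (ghost e)) (gen K (ghost e))
  | ghost_mul_source (e : E.Edge) :
      Rel K E (gen K (ghost e) * gen K (vertex (E.s e))) (gen K (ghost e))
  -- (CK1)
  | ghost_mul_edge_self (e : E.Edge) :
      Rel K E (gen K (ghost e) * gen K (edge e)) (gen K (vertex (E.r e)))
  | ghost_mul_edge_of_ne (e f : E.Edge) (h : e ≠ f) :
      Rel K E (gen K (ghost e) * gen K (edge f)) 0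
  -- (CK2)
  | vertex_eq_sum (a : E.Vertex) (hfin : {e : E.Edge | E.s e = a}.Finite)
      (hne : {e : E.Edge | E.s e = a}.Nonempty) :
      Rel K E (gen K (vertex a)) (∑ e ∈ hfin.toFinset, gen K (edge e) * gen K (ghost e))

/-- The smallest congruence of `K`-algebras containing the defining relations. As the free algebra
has no unit, scalar multiples of the relations have to be put in by hand. -/
noncomputable def leavittCon (K : Type w) [Field K] (E : DirGraph.{u, v}) : RingCon (FreeAlg K E) :=
  ringConGen fun a b => ∃ (k : K) (x y : FreeAlg K E), Rel K E x y ∧ a = k • x ∧ b = k • y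

theorem leavittCon_smul (K : Type w) [Field K] (E : DirGraph.{u, v}) (k : K) {x y : FreeAlg K E}
    (h : leavittCon K E x y) : leavittCon K E (k • x) (k • y) := by
  change RingConGen.Rel _ x y at h
  induction h with
  | of x y h =>
    obtain ⟨l, a, b, hab, rfl, rfl⟩ := h
    exact RingConGen.Rel.of _ _ ⟨k * l, a, b, hab, smul_smul k l a, smul_smul k l b⟩
  | refl x => exact (leavittCon K E).refl _
  | symm _ ih => exact (leavittCon K E).symm ih
  | trans _ _ ih₁ ih₂ => exact (leavittCon K E).trans ih₁ ih₂
  | add _ _ ih₁ ih₂ =>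
    rw [smul_add, smul_add]
    exact (leavittCon K E).add ih₁ ih₂
  | mul _ h₂ ih₁ _ =>
    rw [← smul_mul_assoc, ← smul_mul_assoc]
    exact (leavittCon K E).mul ih₁ h₂

end DirGraph

/-- The Leavitt path algebra `L_K(E)`: the (not necessarily unital) associative `K`-algebra generated
by `v` (`v ∈ E⁰`), `e`, `e*` (`e ∈ E¹`) subject to the relations (V), (E1), (E2), (CK1), (CK2). -/
noncomputable def LeavittPathAlgebra (K : Type w) [Field K] (E : DirGraph.{u, v}) : Type (max u v w) :=
  (DirGraph.leavittCon K E).Quotient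

namespace LeavittPathAlgebra

noncomputable instance instNonUnitalRing (K : Type w) [Field K] (E : DirGraph.{u, v}) :
    NonUnitalRing (LeavittPathAlgebra K E) :=
  inferInstanceAs (NonUnitalRing (DirGraph.leavittCon K E).Quotient)

/-- The quotient map from the free algebra. -/
noncomputable def mk (K : Type w) [Field K] (E : DirGraph.{u, v}) (x : DirGraph.FreeAlg K E) :
    LeavittPathAlgebra K E :=
  (x : (DirGraph.leavittCon K E).Quotient)

noncomputable instance instModule (K : Type w) [Field K] (E : DirGraph.{u, v}) :
    Module K (LeavittPathAlgebra K E) where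
  smul k := Quotient.map (fun x => k • x) fun _ _ h => DirGraph.leavittCon_smul K E k h
  one_smul := by rintro ⟨x⟩; exact congrArg (mk K E) (one_smul K x)
  mul_smul k l := by rintro ⟨x⟩; exact congrArg (mk K E) (mul_smul k l x)
  smul_zero k := congrArg (mk K E) (smul_zero k)
  smul_add k := by rintro ⟨x⟩ ⟨y⟩; exact congrArg (mk K E) (smul_add k x y)
  add_smul k l := by rintro ⟨x⟩; exact congrArg (mk K E) (add_smul k l x)
  zero_smul := by rintro ⟨x⟩; exact congrArg (mk K E) (zero_smul K x)

instance instIsScalarTower (K : Type w) [Field K] (E : DirGraph.{u, v}) :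
    IsScalarTower K (LeavittPathAlgebra K E) (LeavittPathAlgebra K E) where
  smul_assoc k := by rintro ⟨x⟩ ⟨y⟩; exact congrArg (mk K E) (smul_mul_assoc k x y)

instance instSMulCommClass (K : Type w) [Field K] (E : DirGraph.{u, v}) :
    SMulCommClass K (LeavittPathAlgebra K E) (LeavittPathAlgebra K E) where
  smul_comm k := by rintro ⟨x⟩ ⟨y⟩; exact congrArg (mk K E) (mul_smul_comm k x y).symm

end LeavittPathAlgebra

/-- A left module over a possibly nonunital ring `R` is an abelian group `M` with a homomorphism
`φ : R → End(M)`. It is simple if `RM ≠ 0` and its only submodules are `0` and `M`. -/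
def IsSimpleLeftModule {R : Type u} [NonUnitalRing R] {M : Type v} [AddCommGroup M]
    (φ : R →ₙ+* AddMonoid.End M) : Prop :=
  (∃ (a : R) (m : M), φ a m ≠ 0) ∧
    ∀ N : AddSubgroup M, (∀ (a : R), ∀ m ∈ N, φ a m ∈ N) → N = ⊥ ∨ N = ⊤

/-- A left `R`-module is faithful if only `0` annihilates it. -/
def IsFaithfulLeftModule {R : Type u} [NonUnitalRing R] {M : Type v} [AddCommGroup M]
    (φ : R →ₙ+* AddMonoid.End M) : Prop :=
  ∀ a : R, (∀ m : M, φ a m = 0) → a = 0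

/-- `R` is left primitive: it admits a simple faithful left module. (A simple module is generated by
any element `m` with `Rm ≠ 0`, so it is isomorphic to one in the universe of `R`.) -/
def IsLeftPrimitiveRing (R : Type u) [NonUnitalRing R] : Prop :=
  ∃ (M : Type u) (_ : AddCommGroup M) (φ : R →ₙ+* AddMonoid.End M),
    IsSimpleLeftModule φ ∧ IsFaithfulLeftModule φ

/-- `R` is right primitive: its opposite ring is left primitive. -/
def IsRightPrimitiveRing (R : Type u) [NonUnitalRing R] : Prop :=
  IsLeftPrimitiveRing Rᵐᵒᵖ

/-! The module is spanned by maximal paths. (MT3) and countable separation give a maximal path `R`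
to which every vertex connects: a sink if there is one, otherwise an infinite path descending in
turn below each member of a countable separating set (`ConditionMT3.exists_cofinalRay`). On the
maximal paths sharing a tail with `R`, edges prepend themselves and ghost edges delete themselves;
the linear span becomes a left module.

It is simple because a long enough product of ghost edges isolates one basis vector in a finite
combination, and paths with a common tail can be moved to each other
(`CofinalRay.eq_bot_or_eq_top`).

It is faithful by induction on the number of ghost edges needed to write an annihilating element `x`
(`CofinalRay.eq_zero_of_rep_eq_zero`). Induction gives `x e = 0` for every edge `e`, so (CK2)
settles the regular vertices; at the others, maximal paths not starting in a given finite set of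
edges isolate the ghost-free part of `x`. A ghost-free combination is detected by a maximal path
avoiding finitely many periods (`CofinalRay.eq_zero_of_mem_pathSpan`); if `x` itself is ghost-free,
Condition (L) supplies this path (`CofinalRay.exists_tail_forall_ne`).

The involution identifies the algebra with its opposite, which gives the right-hand version. -/

namespace LeavittPathAlgebra

/-! ### Generators, relations and the universal property -/

variable {K : Type w} [Field K] {E : DirGraph.{u, v}}

open DirGraph

theorem mk_surjective (x : LeavittPathAlgebra K E) : ∃ y, mk K E y = x := by
  rcases x with ⟨y⟩
  exact ⟨y, rfl⟩

theorem mk_add (x y : FreeAlg K E) : mk K E (x + y) = mk K E x + mk K E y := rfl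

theorem mk_mul (x y : FreeAlg K E) : mk K E (x * y) = mk K E x * mk K E y := rfl

theorem mk_smul (k : K) (x : FreeAlg K E) : mk K E (k • x) = k • mk K E x := rfl

theorem mk_zero : mk K E 0 = 0 := rfl

theorem mk_sum {ι : Type*} (s : Finset ι) (f : ι → FreeAlg K E) :
    mk K E (∑ i ∈ s, f i) = ∑ i ∈ s, mk K E (f i) :=
  map_sum (⟨⟨mk K E, mk_zero⟩, mk_add⟩ : FreeAlg K E →+ LeavittPathAlgebra K E) f s

theorem mk_eq_of_rel {x y : FreeAlg K E} (h : Rel K E x y) : mk K E x = mk K E y :=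
  Quotient.sound (RingConGen.Rel.of _ _ ⟨1, x, y, h, (one_smul _ _).symm, (one_smul _ _).symm⟩)

variable (K)

/-- A vertex as an element of the Leavitt path algebra. -/
noncomputable def vx (a : E.Vertex) : LeavittPathAlgebra K E := mk K E (gen K (.vertex a))

/-- A real edge as an element of the Leavitt path algebra. -/
noncomputable def ed (e : E.Edge) : LeavittPathAlgebra K E := mk K E (gen K (.edge e))

/-- A ghost edge as an element of the Leavitt path algebra. -/
noncomputable def gh (e : E.Edge) : LeavittPathAlgebra K E := mk K E (gen K (.ghost e))

theorem vx_mul_self (a : E.Vertex) : vx K a * vx K a = vx K a :=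
  mk_eq_of_rel (.vertex_mul_self a)

theorem vx_mul_of_ne {a b : E.Vertex} (h : a ≠ b) : vx K a * vx K b = 0 :=
  mk_eq_of_rel (.vertex_mul_of_ne a b h)

theorem vx_mul_ed (e : E.Edge) : vx K (E.s e) * ed K e = ed K e :=
  mk_eq_of_rel (.source_mul_edge e)

theorem ed_mul_vx (e : E.Edge) : ed K e * vx K (E.r e) = ed K e :=
  mk_eq_of_rel (.edge_mul_range e)

theorem vx_mul_gh (e : E.Edge) : vx K (E.r e) * gh K e = gh K e :=
  mk_eq_of_rel (.range_mul_ghost e)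

theorem gh_mul_vx (e : E.Edge) : gh K e * vx K (E.s e) = gh K e :=
  mk_eq_of_rel (.ghost_mul_source e)

theorem gh_mul_ed_self (e : E.Edge) : gh K e * ed K e = vx K (E.r e) :=
  mk_eq_of_rel (.ghost_mul_edge_self e)

theorem gh_mul_ed_of_ne {e f : E.Edge} (h : e ≠ f) : gh K e * ed K f = 0 :=
  mk_eq_of_rel (.ghost_mul_edge_of_ne e f h)

theorem vx_eq_sum (a : E.Vertex) (hfin : {e : E.Edge | E.s e = a}.Finite)
    (hne : {e : E.Edge | E.s e = a}.Nonempty) :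
    vx K a = ∑ e ∈ hfin.toFinset, ed K e * gh K e :=
  (mk_eq_of_rel (.vertex_eq_sum a hfin hne)).trans (mk_sum _ _)

theorem vx_mul_ed_of_ne {a : E.Vertex} {e : E.Edge} (h : a ≠ E.s e) : vx K a * ed K e = 0 := by
  rw [← vx_mul_ed, ← mul_assoc, vx_mul_of_ne K h, zero_mul]

theorem ed_mul_vx_of_ne {a : E.Vertex} {e : E.Edge} (h : E.r e ≠ a) : ed K e * vx K a = 0 := by
  rw [← ed_mul_vx, mul_assoc, vx_mul_of_ne K h, mul_zero]

theorem gh_mul_vx_of_ne {a : E.Vertex} {e : E.Edge} (h : E.s e ≠ a) : gh K e * vx K a = 0 := by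
  rw [← gh_mul_vx, mul_assoc, vx_mul_of_ne K h, mul_zero]

variable {K}

/-- Induction on the generators of the Leavitt path algebra. -/
theorem induction_on {p : LeavittPathAlgebra K E → Prop} (x : LeavittPathAlgebra K E)
    (vx : ∀ a, p (vx K a)) (ed : ∀ e, p (ed K e)) (gh : ∀ e, p (gh K e)) (zero : p 0)
    (add : ∀ x y, p x → p y → p (x + y)) (mul : ∀ x y, p x → p y → p (x * y))
    (smul : ∀ (k : K) x, p x → p (k • x)) : p x := by
  obtain ⟨x, rfl⟩ := mk_surjective x
  have hword : ∀ m : FreeSemigroup (Gen E), p (mk K E (MonoidAlgebra.single m 1)) := by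
    have hgen : ∀ g : Gen E, p (mk K E (gen K g)) := by
      rintro (a | e | e)
      exacts [vx a, ed e, gh e]
    intro m
    induction m using FreeSemigroup.recOnMul with
    | ih1 g => exact hgen g
    | ih2 g m h1 h2 =>
      have := mul _ _ h1 h2
      rwa [← mk_mul, MonoidAlgebra.single_mul_single, one_mul] at this
  induction x using MonoidAlgebra.induction_linear with
  | zero => exact zero
  | add x y hx hy => exact add _ _ hx hy
  | single m k =>
    have := smul k _ (hword m)
    rwa [← mk_smul, MonoidAlgebra.smul_single, smul_eq_mul, mul_one] at this

section Lift

variable {A : Type*} [NonUnitalRing A] [Module K A] [IsScalarTower K A A] [SMulCommClass K A A]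

/-- The homomorphism from the free algebra determined by the images of the generators. -/
noncomputable def freeLift (K : Type w) [Field K] [Module K A] [IsScalarTower K A A]
    [SMulCommClass K A A] (f : Gen E → A) : FreeAlg K E →ₙₐ[K] A :=
  MonoidAlgebra.liftMagma K (FreeSemigroup.lift f)

theorem freeLift_gen (f : Gen E → A) (g : Gen E) : freeLift K f (gen K g) = f g := by
  simp [freeLift, gen]

theorem freeLift_eq_of_leavittCon (f : Gen E → A)
    (hf : ∀ x y, Rel K E x y → freeLift K f x = freeLift K f y) {x y : FreeAlg K E}
    (h : leavittCon K E x y) : freeLift K f x = freeLift K f y := by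
  change RingConGen.Rel _ x y at h
  induction h with
  | of x y h =>
    obtain ⟨k, a, b, hab, rfl, rfl⟩ := h
    rw [map_smul, map_smul, hf a b hab]
  | refl x => rfl
  | symm _ ih => exact ih.symm
  | trans _ _ ih₁ ih₂ => exact ih₁.trans ih₂
  | add _ _ ih₁ ih₂ => rw [map_add, map_add, ih₁, ih₂]
  | mul _ _ ih₁ ih₂ => rw [map_mul, map_mul, ih₁, ih₂]

/-- The universal property of the Leavitt path algebra. -/
noncomputable def lift (f : Gen E → A)
    (hf : ∀ x y, Rel K E x y → freeLift K f x = freeLift K f y) :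
    LeavittPathAlgebra K E →ₙₐ[K] A where
  toFun := Quotient.lift (freeLift K f) fun _ _ h => freeLift_eq_of_leavittCon f hf h
  map_smul' k := by rintro ⟨x⟩; exact map_smul (freeLift K f) k x
  map_zero' := map_zero (freeLift K f)
  map_add' := by rintro ⟨x⟩ ⟨y⟩; exact map_add (freeLift K f) x y
  map_mul' := by rintro ⟨x⟩ ⟨y⟩; exact map_mul (freeLift K f) x y

theorem lift_mk_gen (f : Gen E → A) (hf) (g : Gen E) : lift (K := K) f hf (mk K E (gen K g)) = f g :=
  freeLift_gen f g

end Lift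

/-! ### The involution and the opposite ring -/

open MulOpposite

/-- The images of the generators under the canonical involution. -/
noncomputable def starGen (K : Type w) [Field K] : Gen E → (LeavittPathAlgebra K E)ᵐᵒᵖ
  | .vertex a => op (vx K a)
  | .edge e => op (gh K e)
  | .ghost e => op (ed K e)

instance : IsScalarTower K (LeavittPathAlgebra K E)ᵐᵒᵖ (LeavittPathAlgebra K E)ᵐᵒᵖ where
  smul_assoc k x y := unop_injective (mul_smul_comm k (unop y) (unop x))

instance : SMulCommClass K (LeavittPathAlgebra K E)ᵐᵒᵖ (LeavittPathAlgebra K E)ᵐᵒᵖ where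
  smul_comm k x y := unop_injective (smul_mul_assoc k (unop y) (unop x)).symm

/-- The canonical involution as a homomorphism to the opposite algebra. -/
noncomputable def starHom (K : Type w) [Field K] (E : DirGraph.{u, v}) :
    LeavittPathAlgebra K E →ₙₐ[K] (LeavittPathAlgebra K E)ᵐᵒᵖ :=
  lift (starGen K) <| by
    intro x y h
    induction h with
    | vertex_mul_self a =>
      simp only [map_mul, freeLift_gen, starGen, ← op_mul, vx_mul_self]
    | vertex_mul_of_ne a b h =>
      simp only [map_mul, freeLift_gen, starGen, ← op_mul, vx_mul_of_ne K h.symm, map_zero, op_zero]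
    | source_mul_edge e => simp only [map_mul, freeLift_gen, starGen, ← op_mul, gh_mul_vx]
    | edge_mul_range e => simp only [map_mul, freeLift_gen, starGen, ← op_mul, vx_mul_gh]
    | range_mul_ghost e => simp only [map_mul, freeLift_gen, starGen, ← op_mul, ed_mul_vx]
    | ghost_mul_source e => simp only [map_mul, freeLift_gen, starGen, ← op_mul, vx_mul_ed]
    | ghost_mul_edge_self e => simp only [map_mul, freeLift_gen, starGen, ← op_mul, gh_mul_ed_self]
    | ghost_mul_edge_of_ne e f h =>
      simp only [map_mul, freeLift_gen, starGen, ← op_mul, gh_mul_ed_of_ne K h.symm, map_zero,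
        op_zero]
    | vertex_eq_sum a hfin hne =>
      simp only [map_sum, map_mul, freeLift_gen, starGen, ← op_mul, ← Finset.op_sum,
        vx_eq_sum K a hfin hne]

theorem starHom_starHom (x : LeavittPathAlgebra K E) :
    unop (starHom K E (unop (starHom K E x))) = x := by
  have hg : ∀ g : Gen E, starHom K E (mk K E (gen K g)) = starGen K g := lift_mk_gen _ _
  have hv (a : E.Vertex) : starHom K E (vx K a) = op (vx K a) := hg _
  have he (e : E.Edge) : starHom K E (ed K e) = op (gh K e) := hg _
  have hh (e : E.Edge) : starHom K E (gh K e) = op (ed K e) := hg _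
  induction x using induction_on with
  | vx a => simp [hv]
  | ed e => simp [he, hh]
  | gh e => simp [he, hh]
  | zero => simp
  | add x y hx hy => simp [hx, hy]
  | mul x y hx hy => simp [hx, hy]
  | smul k x hx => simp [hx]

/-- The canonical involution as an isomorphism to the opposite ring. -/
noncomputable def starEquiv (K : Type w) [Field K] (E : DirGraph.{u, v}) :
    LeavittPathAlgebra K E ≃+* (LeavittPathAlgebra K E)ᵐᵒᵖ where
  toFun := starHom K E
  invFun x := unop (starHom K E (unop x))
  left_inv := starHom_starHom
  right_inv x := unop_injective (starHom_starHom (unop x))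
  map_mul' := map_mul _
  map_add' := map_add _

end LeavittPathAlgebra

theorem IsLeftPrimitiveRing.of_ringEquiv {R S : Type u} [NonUnitalRing R] [NonUnitalRing S]
    (h : IsLeftPrimitiveRing R) (f : R ≃+* S) : IsLeftPrimitiveRing S := by
  obtain ⟨M, hM, φ, ⟨⟨a, m, ham⟩, hs⟩, hf⟩ := h
  refine ⟨M, hM, φ.comp (f.symm : S →ₙ+* R), ⟨⟨f a, m, by simpa using ham⟩, fun N hN => ?_⟩,
    fun a ha => ?_⟩
  · exact hs N fun a m hm => by simpa using hN (f a) m hm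
  · simpa using hf (f.symm a) fun m => by simpa using ha m

/-! ### Maximal paths with a common tail -/

namespace DirGraph

/-- The vertex `a` emits no edges. -/
def IsSink (E : DirGraph.{u, v}) (a : E.Vertex) : Prop := ∀ e, E.s e ≠ a

/-- A maximal path cofinal in `E`: either an infinite path, or a path ending at a sink, where it is
continued by `none`; every vertex of `E` connects to a vertex on it. -/
structure CofinalRay (E : DirGraph.{u, v}) where
  /-- The vertices on the path. -/
  vert : ℕ → E.Vertex
  /-- The edges on the path. -/
  edge : Stream' (Option E.Edge)
  step : ∀ n, (∃ e, edge n = some e ∧ E.s e = vert n ∧ E.r e = vert (n + 1)) ∨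
    (edge n = none ∧ E.IsSink (vert n) ∧ vert (n + 1) = vert n)
  cofinal : ∀ a, ∃ n, E.Connects a (vert n)

variable {E : DirGraph.{u, v}}

/-- `R.Tail a x`: `x` is a maximal path starting at `a` which has a tail in common with `R`. -/
inductive CofinalRay.Tail (R : E.CofinalRay) : E.Vertex → Stream' (Option E.Edge) → Prop
  | base (n : ℕ) : Tail R (R.vert n) (R.edge.drop n)
  | cons (e : E.Edge) {x : Stream' (Option E.Edge)} (h : Tail R (E.r e) x) :
      Tail R (E.s e) (Stream'.cons (some e) x)

variable {R : E.CofinalRay} {a : E.Vertex} {x : Stream' (Option E.Edge)}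

/-- Makes the action of ghost edges well defined: deleting the first edge does not leave the tail
class. -/
theorem CofinalRay.Tail.of_head_eq_some (h : R.Tail a x) {e : E.Edge} (he : x.head = some e) :
    E.s e = a ∧ R.Tail (E.r e) x.tail := by
  cases h with
  | base n =>
    have he' : R.edge n = some e := by
      rw [← he, Stream'.head_drop]; rfl
    rcases R.step n with ⟨f, hf, hs, hr⟩ | ⟨hn, -⟩
    · obtain rfl : e = f := Option.some_injective _ (he'.symm.trans hf)
      refine ⟨hs, ?_⟩
      rw [hr, Stream'.tail_drop']
      exact .base (n + 1)
    · rw [hn] at he'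
      cases he'
  | cons f h =>
    obtain rfl : f = e := Option.some_injective _ he
    exact ⟨rfl, h⟩

/-- Maximality in the form needed for (CK2): a path stops only where it cannot be continued. -/
theorem CofinalRay.Tail.isSink_of_head_eq_none (h : R.Tail a x) (hx : x.head = none) :
    E.IsSink a := by
  cases h with
  | base n =>
    have hx' : R.edge n = none := by
      rw [← hx, Stream'.head_drop]; rfl
    rcases R.step n with ⟨f, hf, -⟩ | ⟨-, hn, -⟩
    · rw [hf] at hx'
      cases hx'
    · exact hn
  | cons f h => cases hx

theorem CofinalRay.edge_of_isSink {n : ℕ} (h : E.IsSink (R.vert n)) (k : ℕ) :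
    R.vert (n + k) = R.vert n ∧ R.edge (n + k) = none := by
  have key : ∀ m, E.IsSink (R.vert m) → R.vert (m + 1) = R.vert m ∧ R.edge m = none := by
    intro m hm
    rcases R.step m with ⟨f, -, hf, -⟩ | ⟨h1, -, h2⟩
    · exact absurd hf (hm f)
    · exact ⟨h2, h1⟩
  induction k with
  | zero => exact ⟨rfl, (key n h).2⟩
  | succ k ih =>
    have h1 := key (n + k) (ih.1 ▸ h)
    have h2 : R.vert (n + (k + 1)) = R.vert n := h1.1.trans ih.1
    exact ⟨h2, (key _ (h2 ▸ h)).2⟩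

theorem CofinalRay.Tail.eq_const_of_isSink (h : R.Tail a x) (ha : E.IsSink a) :
    x = Stream'.const none := by
  cases h with
  | base n =>
    ext1 k
    rw [Stream'.get_drop]
    exact (CofinalRay.edge_of_isSink ha k).2
  | cons f h => exact absurd rfl (ha f)

theorem IsPath.exists_tail {b : E.Vertex} {p : List E.Edge} (hp : E.IsPath a p b)
    (hx : R.Tail b x) : R.Tail a (p.map some ++ₛ x) := by
  induction hp with
  | nil a => exact hx
  | cons e h ih => exact .cons e (ih hx)

/-- The only use of cofinality; faithfulness needs basis vectors at every vertex. -/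
theorem CofinalRay.exists_tail (R : E.CofinalRay) (a : E.Vertex) : ∃ x, R.Tail a x := by
  obtain ⟨n, p, hp⟩ := R.cofinal a
  exact ⟨_, hp.exists_tail (.base n)⟩

/-- The maximal paths which have a tail in common with `R`. -/
abbrev CofinalRay.Point (R : E.CofinalRay) : Type (max u v) :=
  {x : E.Vertex × Stream' (Option E.Edge) // R.Tail x.1 x.2}

open Classical in
/-- The partial action of the generators on maximal paths: edges are put in front, ghost edges are
removed. -/
noncomputable def CofinalRay.pact (R : E.CofinalRay) : Gen E → R.Point → Option R.Point
  | .vertex a, x => if x.1.1 = a then some x else none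
  | .edge e, x =>
    if h : x.1.1 = E.r e then some ⟨(E.s e, Stream'.cons (some e) x.1.2), .cons e (h ▸ x.2)⟩
    else none
  | .ghost e, x =>
    if h : x.1.2.head = some e then some ⟨(E.r e, x.1.2.tail), (x.2.of_head_eq_some h).2⟩ else none

/-! ### The representation on maximal paths -/

variable (K : Type w) [Field K]

/-- The linear extension of a partial map. -/
noncomputable def linExt {X : Type*} (f : X → Option X) : Module.End K (X →₀ K) :=
  Finsupp.linearCombination K fun x => (f x).elim 0 fun y => Finsupp.single y 1

variable {K}

theorem linExt_single {X : Type*} (f : X → Option X) (x : X) (k : K) :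
    linExt K f (Finsupp.single x k) = (f x).elim 0 fun y => Finsupp.single y k := by
  rw [linExt, Finsupp.linearCombination_single]
  cases f x <;> simp

/-- Reduces the relations between monomials to identities between partial maps. -/
theorem linExt_mul {X : Type*} (f g : X → Option X) :
    linExt K f * linExt K g = linExt K fun x => (g x).bind f := by
  ext1 x
  ext1
  simp only [LinearMap.comp_apply, Module.End.mul_apply, Finsupp.lsingle_apply, linExt_single]
  cases g x <;> simp [linExt_single]

theorem linExt_none {X : Type*} : linExt K (fun _ : X => none) = 0 := by
  ext1 x
  ext1
  simp only [LinearMap.comp_apply, Finsupp.lsingle_apply, linExt_single]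
  rfl

variable (K)

/-- The action of the Leavitt path algebra on the space spanned by maximal paths. -/
noncomputable def CofinalRay.rep (R : E.CofinalRay) :
    LeavittPathAlgebra K E →ₙₐ[K] Module.End K (R.Point →₀ K) :=
  LeavittPathAlgebra.lift (fun g => linExt K (R.pact g)) <| by
    classical
    intro x y h
    induction h with
    | vertex_mul_self a =>
      simp only [map_mul, LeavittPathAlgebra.freeLift_gen, linExt_mul]
      congr 1; ext1 x
      by_cases h : x.1.1 = a <;> simp [CofinalRay.pact, h]
    | vertex_mul_of_ne a b h =>
      simp only [map_mul, LeavittPathAlgebra.freeLift_gen, linExt_mul, map_zero, ← linExt_none]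
      congr 1; ext1 x
      by_cases h' : x.1.1 = b
      · simp [CofinalRay.pact, h', h.symm]
      · simp [CofinalRay.pact, h']
    | source_mul_edge e =>
      simp only [map_mul, LeavittPathAlgebra.freeLift_gen, linExt_mul]
      congr 1; ext1 x
      by_cases h : x.1.1 = E.r e <;> simp [CofinalRay.pact, h]
    | edge_mul_range e =>
      simp only [map_mul, LeavittPathAlgebra.freeLift_gen, linExt_mul]
      congr 1; ext1 x
      by_cases h : x.1.1 = E.r e <;> simp [CofinalRay.pact, h]
    | range_mul_ghost e =>
      simp only [map_mul, LeavittPathAlgebra.freeLift_gen, linExt_mul]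
      congr 1; ext1 x
      by_cases h : x.1.2.head = some e <;> simp [CofinalRay.pact, h]
    | ghost_mul_source e =>
      simp only [map_mul, LeavittPathAlgebra.freeLift_gen, linExt_mul]
      congr 1; ext1 x
      by_cases h : x.1.2.head = some e
      · have := (x.2.of_head_eq_some h).1.symm
        simp [CofinalRay.pact, this]
      · by_cases h' : x.1.1 = E.s e <;> simp [CofinalRay.pact, h, h']
    | ghost_mul_edge_self e =>
      simp only [map_mul, LeavittPathAlgebra.freeLift_gen, linExt_mul]
      congr 1; ext1 x
      by_cases h : x.1.1 = E.r e
      · simp [CofinalRay.pact, h, Subtype.ext_iff, Prod.ext_iff]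
      · simp [CofinalRay.pact, h]
    | ghost_mul_edge_of_ne e f h =>
      simp only [map_mul, LeavittPathAlgebra.freeLift_gen, linExt_mul, map_zero, ← linExt_none]
      congr 1; ext1 x
      by_cases h' : x.1.1 = E.r f <;> simp [CofinalRay.pact, h', h.symm]
    | vertex_eq_sum a hfin hne =>
      simp only [map_mul, map_sum, LeavittPathAlgebra.freeLift_gen, linExt_mul]
      ext1 x
      ext1
      simp only [LinearMap.comp_apply, Finsupp.lsingle_apply, LinearMap.sum_apply, linExt_single]
      -- The product `e e*` projects onto the maximal paths with first edge `e`, so at most one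
      -- summand survives on `x`.
      have hval : ∀ e, (R.pact (.ghost e) x).bind (R.pact (.edge e)) =
          if x.1.2.head = some e then some x else none := by
        intro e
        by_cases h : x.1.2.head = some e
        · have hs := (x.2.of_head_eq_some h).1
          have heq : Stream'.cons (some e) x.1.2.tail = x.1.2 := by
            rw [← h, Stream'.eta]
          simp [CofinalRay.pact, h, heq, hs]
        · simp [CofinalRay.pact, h]
      simp only [hval]
      by_cases h : x.1.1 = a
      · obtain ⟨f, hf⟩ : ∃ f, x.1.2.head = some f := by
          by_contra hno
          obtain ⟨e, he⟩ := hne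
          exact x.2.isSink_of_head_eq_none (Option.eq_none_iff_forall_not_mem.2
            fun f hf => hno ⟨f, hf⟩) e (he.trans h.symm)
        have hfa : f ∈ hfin.toFinset := by
          simpa [h] using (x.2.of_head_eq_some hf).1
        rw [Finset.sum_eq_single_of_mem f hfa]
        · simp [hf, CofinalRay.pact, h]
        · intro e _ hne
          simp [hf, hne.symm]
      · rw [Finset.sum_eq_zero]
        · simp [CofinalRay.pact, h]
        · intro e he
          rw [if_neg]
          · rfl
          · intro hx
            exact h ((x.2.of_head_eq_some hx).1.symm.trans (by simpa using he))

variable {K}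

open LeavittPathAlgebra

theorem CofinalRay.rep_vx_single (a : E.Vertex) (x : R.Point) (k : K) (h : x.1.1 = a) :
    R.rep K (vx K a) (Finsupp.single x k) = Finsupp.single x k := by
  rw [CofinalRay.rep, vx, lift_mk_gen, linExt_single]
  simp [CofinalRay.pact, h]

theorem CofinalRay.rep_vx_single_of_ne (a : E.Vertex) (x : R.Point) (k : K) (h : x.1.1 ≠ a) :
    R.rep K (vx K a) (Finsupp.single x k) = 0 := by
  rw [CofinalRay.rep, vx, lift_mk_gen, linExt_single]
  simp [CofinalRay.pact, h]

theorem CofinalRay.rep_ed_single (e : E.Edge) (x : R.Point) (k : K) (h : x.1.1 = E.r e) :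
    R.rep K (ed K e) (Finsupp.single x k) =
      Finsupp.single ⟨(E.s e, Stream'.cons (some e) x.1.2), .cons e (h ▸ x.2)⟩ k := by
  rw [CofinalRay.rep, ed, lift_mk_gen, linExt_single]
  simp [CofinalRay.pact, h]

theorem CofinalRay.rep_gh_single (e : E.Edge) (x : R.Point) (k : K) (h : x.1.2.head = some e) :
    R.rep K (gh K e) (Finsupp.single x k) =
      Finsupp.single ⟨(E.r e, x.1.2.tail), (x.2.of_head_eq_some h).2⟩ k := by
  rw [CofinalRay.rep, gh, lift_mk_gen, linExt_single]
  simp [CofinalRay.pact, h]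

theorem CofinalRay.rep_gh_single_of_ne (e : E.Edge) (x : R.Point) (k : K)
    (h : x.1.2.head ≠ some e) : R.rep K (gh K e) (Finsupp.single x k) = 0 := by
  rw [CofinalRay.rep, gh, lift_mk_gen, linExt_single]
  simp [CofinalRay.pact, h]

end DirGraph

/-! ### Simplicity of the module -/

namespace DirGraph

open LeavittPathAlgebra

variable {K : Type w} [Field K] {E : DirGraph.{u, v}} {R : E.CofinalRay}

/-- The product of ghost edges which removes the first `n` edges of the maximal path `x`. -/
noncomputable def prefixGhost (K : Type w) [Field K] {E : DirGraph.{u, v}} :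
    ℕ → E.Vertex → Stream' (Option E.Edge) → LeavittPathAlgebra K E
  | 0, a, _ => vx K a
  | n + 1, a, x => x.head.elim (vx K a) fun e => prefixGhost K n (E.r e) x.tail * gh K e

theorem CofinalRay.exists_rep_prefixGhost (n : ℕ) (x : R.Point) :
    ∃ y : R.Point, ∀ k, R.rep K (prefixGhost K n x.1.1 x.1.2) (Finsupp.single x k) =
      Finsupp.single y k := by
  induction n generalizing x with
  | zero => exact ⟨x, fun k => R.rep_vx_single _ x k rfl⟩
  | succ n ih =>
    cases hx : x.1.2.head with
    | none =>
      refine ⟨x, fun k => ?_⟩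
      rw [prefixGhost, hx]
      exact R.rep_vx_single _ x k rfl
    | some e =>
      obtain ⟨y, hy⟩ := ih ⟨(E.r e, x.1.2.tail), (x.2.of_head_eq_some hx).2⟩
      refine ⟨y, fun k => ?_⟩
      rw [prefixGhost, hx, Option.elim_some, map_mul, Module.End.mul_apply,
        R.rep_gh_single e x k hx]
      exact hy k

theorem CofinalRay.eq_of_rep_vx_ne_zero {a : E.Vertex} {y : R.Point} {k : K}
    (h : R.rep K (vx K a) (Finsupp.single y k) ≠ 0) : y.1.1 = a :=
  not_not.1 fun hne => h (R.rep_vx_single_of_ne a y k hne)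

/-- Each ghost edge kills the paths starting differently. If `x` ends before `n` edges are removed,
the test at the sink suffices, since only one maximal path starts there. -/
theorem CofinalRay.eq_of_rep_prefixGhost_ne_zero (n : ℕ) (x y : R.Point) (k : K)
    (h : R.rep K (prefixGhost K n x.1.1 x.1.2) (Finsupp.single y k) ≠ 0) :
    y.1.1 = x.1.1 ∧ ∀ i < n, y.1.2.get i = x.1.2.get i := by
  induction n generalizing x y with
  | zero => exact ⟨eq_of_rep_vx_ne_zero h, fun i hi => absurd hi i.not_lt_zero⟩
  | succ n ih =>
    cases hx : x.1.2.head with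
    | none =>
      rw [prefixGhost, hx] at h
      have hxy : y.1.1 = x.1.1 := eq_of_rep_vx_ne_zero h
      have hs := x.2.isSink_of_head_eq_none hx
      refine ⟨hxy, fun i _ => ?_⟩
      rw [x.2.eq_const_of_isSink hs, y.2.eq_const_of_isSink (hxy ▸ hs)]
    | some e =>
      rw [prefixGhost, hx, Option.elim_some, map_mul, Module.End.mul_apply] at h
      have hy : y.1.2.head = some e := by
        by_contra hne
        exact h (by rw [R.rep_gh_single_of_ne e y k hne, map_zero])
      rw [R.rep_gh_single e y k hy] at h
      refine ⟨(y.2.of_head_eq_some hy).1.symm.trans (x.2.of_head_eq_some hx).1, ?_⟩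
      have ih' := ih ⟨(E.r e, x.1.2.tail), (x.2.of_head_eq_some hx).2⟩ _ h
      rintro (_ | i) hi
      · exact hy.trans hx.symm
      · exact ih'.2 i (by omega)

/-- A nonzero vector can be moved to a nonzero multiple of a basis vector. -/
theorem CofinalRay.exists_rep_eq_single {m : R.Point →₀ K} (hm : m ≠ 0) :
    ∃ (a : LeavittPathAlgebra K E) (x : R.Point) (k : K), k ≠ 0 ∧
      R.rep K a m = Finsupp.single x k := by
  obtain ⟨x, hx⟩ := Finsupp.support_nonempty_iff.2 hm
  have hsep : ∀ y : R.Point, ∃ n₀, ∀ n ≥ n₀,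
      (y.1.1 = x.1.1 ∧ ∀ i < n, y.1.2.get i = x.1.2.get i) → y = x := by
    intro y
    by_cases h : ∃ i, y.1.2.get i ≠ x.1.2.get i
    · obtain ⟨i, hi⟩ := h
      exact ⟨i + 1, fun n hn hy => absurd (hy.2 i (by omega)) hi⟩
    · push Not at h
      exact ⟨0, fun n _ hy => Subtype.ext (Prod.ext hy.1 (Stream'.ext h))⟩
  choose N hN using hsep
  -- The support is finite, so one prefix length separates `x` from all its other members.
  let n := m.support.sup N
  obtain ⟨z, hz⟩ := R.exists_rep_prefixGhost (K := K) n x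
  refine ⟨prefixGhost K n x.1.1 x.1.2, z, m x, Finsupp.mem_support_iff.1 hx, ?_⟩
  conv_lhs => rw [← m.sum_single, Finsupp.sum, map_sum]
  rw [Finset.sum_eq_single_of_mem x hx, hz]
  intro y hy hne
  by_contra h
  exact hne (hN y n (Finset.le_sup hy) (R.eq_of_rep_prefixGhost_ne_zero n x y _ h))

/-- Some element of the algebra moves the basis vector `x` to the basis vector `y`. -/
def CofinalRay.Moves (K : Type w) [Field K] (R : E.CofinalRay) (x y : R.Point) : Prop :=
  ∃ a : LeavittPathAlgebra K E, ∀ k : K,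
    R.rep K a (Finsupp.single x k) = Finsupp.single y k

theorem CofinalRay.Moves.trans {x y z : R.Point} (h : R.Moves K x y) (h' : R.Moves K y z) :
    R.Moves K x z := by
  obtain ⟨a, ha⟩ := h
  obtain ⟨b, hb⟩ := h'
  exact ⟨b * a, fun k => by rw [map_mul, Module.End.mul_apply, ha, hb]⟩

theorem CofinalRay.moves_self (x : R.Point) : R.Moves K x x :=
  ⟨vx K x.1.1, fun k => R.rep_vx_single _ x k rfl⟩

theorem CofinalRay.moves_tail (x : R.Point) {e : E.Edge} (h : x.1.2.head = some e) :
    R.Moves K x ⟨(E.r e, x.1.2.tail), (x.2.of_head_eq_some h).2⟩ ∧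
      R.Moves K ⟨(E.r e, x.1.2.tail), (x.2.of_head_eq_some h).2⟩ x := by
  refine ⟨⟨gh K e, fun k => R.rep_gh_single e x k h⟩, ed K e, fun k => ?_⟩
  rw [R.rep_ed_single e _ k rfl]
  congr 1
  refine Subtype.ext (Prod.ext (x.2.of_head_eq_some h).1 ?_)
  change Stream'.cons (some e) x.1.2.tail = x.1.2
  rw [← h, Stream'.eta]

theorem CofinalRay.moves_base (n : ℕ) :
    R.Moves K ⟨(R.vert n, R.edge.drop n), .base n⟩ ⟨(R.vert 0, R.edge.drop 0), .base 0⟩ ∧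
      R.Moves K ⟨(R.vert 0, R.edge.drop 0), .base 0⟩ ⟨(R.vert n, R.edge.drop n), .base n⟩ := by
  induction n with
  | zero => exact ⟨moves_self _, moves_self _⟩
  | succ n ih =>
    rcases R.step n with ⟨e, he, -, hr⟩ | ⟨h0, hs, hv⟩
    · have hh : (R.edge.drop n).head = some e := by
        rw [Stream'.head_drop]; exact he
      have h := R.moves_tail (K := K) ⟨(R.vert n, R.edge.drop n), .base n⟩ hh
      have heq : (⟨(E.r e, (R.edge.drop n).tail), (Tail.base n |>.of_head_eq_some hh).2⟩ :
          R.Point) = ⟨(R.vert (n + 1), R.edge.drop (n + 1)), .base (n + 1)⟩ :=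
        Subtype.ext (Prod.ext hr Stream'.tail_drop')
      simp only at h
      rw [heq] at h
      exact ⟨h.2.trans ih.1, ih.2.trans h.1⟩
    -- At a sink the ray is stationary, and both indices name the same basis vector.
    · have heq : (⟨(R.vert (n + 1), R.edge.drop (n + 1)), .base (n + 1)⟩ : R.Point) =
          ⟨(R.vert n, R.edge.drop n), .base n⟩ := by
        refine Subtype.ext (Prod.ext hv ?_)
        change R.edge.drop (n + 1) = R.edge.drop n
        rw [(Tail.base n).eq_const_of_isSink hs,
          (Tail.base (n + 1)).eq_const_of_isSink (hv.symm ▸ hs)]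
      rwa [heq]

theorem CofinalRay.moves_base_zero {a : E.Vertex} {x : Stream' (Option E.Edge)} (h : R.Tail a x) :
    R.Moves K ⟨(a, x), h⟩ ⟨(R.vert 0, R.edge.drop 0), .base 0⟩ ∧
      R.Moves K ⟨(R.vert 0, R.edge.drop 0), .base 0⟩ ⟨(a, x), h⟩ := by
  induction h with
  | base n => exact moves_base n
  | cons e h ih =>
    have h' := R.moves_tail (K := K) ⟨(E.s e, _), Tail.cons e h⟩ (Stream'.head_cons _ _)
    exact ⟨h'.1.trans ih.1, ih.2.trans h'.2⟩

/-- Go through the start of `R`: delete edges down to the common tail, then prepend others. -/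
theorem CofinalRay.moves (x y : R.Point) : R.Moves K x y :=
  (moves_base_zero x.2).1.trans (moves_base_zero y.2).2

theorem CofinalRay.eq_bot_or_eq_top (N : AddSubgroup (R.Point →₀ K))
    (hN : ∀ a, ∀ m ∈ N, R.rep K a m ∈ N) : N = ⊥ ∨ N = ⊤ := by
  rw [or_iff_not_imp_left]
  intro hne
  obtain ⟨m, hm, hm0⟩ := N.bot_or_exists_ne_zero.resolve_left hne
  obtain ⟨a, x, k, hk, hax⟩ := R.exists_rep_eq_single hm0
  have hx : Finsupp.single x k ∈ N := hax ▸ hN a m hm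
  rw [eq_top_iff]
  rintro n -
  induction n using Finsupp.induction_linear with
  | zero => exact N.zero_mem
  | add _ _ h₁ h₂ => exact N.add_mem h₁ h₂
  | single y l =>
    obtain ⟨b, hb⟩ := R.moves (K := K) x y
    -- Submodules are only additive subgroups here, so the scalar has to come from the algebra.
    have := hN ((l * k⁻¹) • b) _ hx
    rwa [map_smul, LinearMap.smul_apply, hb, Finsupp.smul_single, smul_eq_mul, mul_assoc,
      inv_mul_cancel₀ hk, mul_one] at this

/-- The module spanned by maximal paths. -/
noncomputable def CofinalRay.repEnd (K : Type w) [Field K] (R : E.CofinalRay) :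
    LeavittPathAlgebra K E →ₙ+* AddMonoid.End (R.Point →₀ K) :=
  (Module.toAddMonoidEnd (Module.End K (R.Point →₀ K)) (R.Point →₀ K) :
    Module.End K (R.Point →₀ K) →ₙ+* AddMonoid.End (R.Point →₀ K)).comp
    (R.rep K : LeavittPathAlgebra K E →ₙ+* Module.End K (R.Point →₀ K))

theorem CofinalRay.repEnd_apply (a : LeavittPathAlgebra K E) (m : R.Point →₀ K) :
    R.repEnd K a m = R.rep K a m := rfl

theorem CofinalRay.isSimple (R : E.CofinalRay) : IsSimpleLeftModule (R.repEnd K) := by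
  refine ⟨⟨vx K (R.vert 0), Finsupp.single ⟨(R.vert 0, R.edge.drop 0), .base 0⟩ 1, ?_⟩,
    fun N hN => R.eq_bot_or_eq_top N hN⟩
  rw [R.repEnd_apply, R.rep_vx_single (R.vert 0) _ _ rfl]
  simp

end DirGraph

/-! ### Paths, cycles and Condition (L) -/

namespace DirGraph

variable {E : DirGraph.{u, v}}

theorem IsPath.append {a b c : E.Vertex} {p q : List E.Edge} (hp : E.IsPath a p b)
    (hq : E.IsPath b q c) : E.IsPath a (p ++ q) c := by
  induction hp with
  | nil a => exact hq
  | cons e h ih => exact .cons e (ih hq)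

theorem IsPath.exists_of_append {a c : E.Vertex} {p q : List E.Edge} (h : E.IsPath a (p ++ q) c) :
    ∃ b, E.IsPath a p b ∧ E.IsPath b q c := by
  induction p generalizing a with
  | nil => exact ⟨a, .nil a, h⟩
  | cons e p ih =>
    rw [List.cons_append] at h
    cases h with
    | cons e h =>
      obtain ⟨b, hp, hq⟩ := ih h
      exact ⟨b, .cons e hp, hq⟩

theorem IsPath.source_eq {a b : E.Vertex} {e : E.Edge} {p : List E.Edge}
    (h : E.IsPath a (e :: p) b) : E.s e = a := by
  cases h; rfl

theorem IsPath.tail {a b : E.Vertex} {e : E.Edge} {p : List E.Edge}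
    (h : E.IsPath a (e :: p) b) : E.IsPath (E.r e) p b := by
  cases h; assumption

theorem IsPath.eq_of_nil {a b : E.Vertex} (h : E.IsPath a [] b) : a = b := by
  cases h; rfl

theorem Connects.trans {a b c : E.Vertex} (h : E.Connects a b) (h' : E.Connects b c) :
    E.Connects a c := by
  obtain ⟨p, hp⟩ := h
  obtain ⟨q, hq⟩ := h'
  exact ⟨p ++ q, hp.append hq⟩

theorem IsSink.eq_of_connects {a b : E.Vertex} (ha : E.IsSink a) (h : E.Connects a b) : b = a := by
  obtain ⟨p, hp⟩ := h
  cases hp with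
  | nil => rfl
  | cons e h => exact absurd rfl (ha e)

theorem exists_eq_append_of_not_nodup_map {α β : Type*} (f : α → β) (l : List α)
    (h : ¬ (l.map f).Nodup) :
    ∃ (p q r : List α) (x y : α), l = p ++ x :: q ++ y :: r ∧ f x = f y := by
  induction l with
  | nil => simp at h
  | cons x l ih =>
    rw [List.map_cons, List.nodup_cons, not_and_or, not_not] at h
    rcases h with h | h
    · obtain ⟨y, hy, hxy⟩ := List.mem_map.1 h
      obtain ⟨q, r, rfl⟩ := List.append_of_mem hy
      exact ⟨[], q, r, x, y, rfl, hxy.symm⟩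
    · obtain ⟨p, q, r, y, z, rfl, hyz⟩ := ih h
      exact ⟨x :: p, q, r, y, z, rfl, hyz⟩

/-- A vertex on a closed path of positive length is the base of a cycle. -/
theorem exists_isCycle {a : E.Vertex} (p : List E.Edge) (hp : p ≠ []) (h : E.IsPath a p a) :
    ∃ c, E.IsCycle a c := by
  induction hn : p.length using Nat.strong_induction_on generalizing p with
  | _ n ih =>
    by_cases hnd : (p.map E.s).Nodup
    · exact ⟨p, hp, h, hnd⟩
    · obtain ⟨p₁, p₂, p₃, e, f, rfl, hef⟩ := exists_eq_append_of_not_nodup_map E.s p hnd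
      obtain ⟨c, h₁, h₂⟩ := h.exists_of_append
      obtain ⟨b, h₃, h₄⟩ := h₁.exists_of_append
      have hbc : b = c := by rw [← h₂.source_eq, ← h₄.source_eq, hef]
      -- Cut out the loop between two visits to the same vertex; the base stays, and `f` keeps the
      -- path nonempty.
      refine ih _ ?_ (p₁ ++ f :: p₃) (by simp) (h₃.append (hbc ▸ h₂)) rfl
      rw [← hn]
      simp only [List.length_append, List.length_cons]
      omega

/-- Such a stream is `l` repeated forever. -/
theorem append_stream_inj_of_eq {α : Type*} {l : List α} (hl : l ≠ []) {x y : Stream' α}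
    (hx : x = l ++ₛ x) (hy : y = l ++ₛ y) : x = y := by
  ext1 n
  induction n using Nat.strong_induction_on with
  | _ n ih =>
    rw [hx, hy]
    by_cases hn : n < l.length
    · rw [Stream'.get_append_left _ _ _ hn, Stream'.get_append_left _ _ _ hn]
    · obtain ⟨m, rfl⟩ := Nat.exists_eq_add_of_le (not_lt.1 hn)
      rw [Stream'.get_append_right, Stream'.get_append_right]
      exact ih m (by have := List.length_pos_iff.2 hl; omega)

variable {R : E.CofinalRay}

theorem CofinalRay.Tail.exists_of_append {a : E.Vertex} {p : List E.Edge}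
    {x : Stream' (Option E.Edge)} (h : R.Tail a (p.map some ++ₛ x)) :
    ∃ b, E.IsPath a p b ∧ R.Tail b x := by
  induction p generalizing a with
  | nil => exact ⟨a, .nil a, h⟩
  | cons e p ih =>
    rw [List.map_cons, Stream'.cons_append_stream] at h
    obtain ⟨rfl, h'⟩ := h.of_head_eq_some (Stream'.head_cons _ _)
    rw [Stream'.tail_cons] at h'
    obtain ⟨b, hp, hb⟩ := ih h'
    exact ⟨b, .cons e hp, hb⟩

/-- Under Condition (L), infinitely many maximal paths start at the base of a cycle. -/
theorem CofinalRay.infinite_tail (R : E.CofinalRay) (hL : E.ConditionL) {a : E.Vertex}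
    {c : List E.Edge} (hc : E.IsCycle a c) : {x | R.Tail a x}.Infinite := by
  intro hfin
  obtain ⟨e, f, hf, hs, hef⟩ := hL a c hc
  obtain ⟨c₁, c₂, rfl⟩ := List.append_of_mem hf
  obtain ⟨b, h₁, h₂⟩ := hc.2.1.exists_of_append
  obtain ⟨x, hx⟩ := R.exists_tail (E.r e)
  have hy : c₁.map some ++ₛ Stream'.cons (some e) x ∈ {x | R.Tail a x} := by
    refine h₁.exists_tail ?_
    rw [← h₂.source_eq, ← hs]
    exact .cons e hx
  have hmaps : Set.MapsTo (fun z => (c₁ ++ f :: c₂).map some ++ₛ z) {x | R.Tail a x}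
      {x | R.Tail a x} := fun z hz => hc.2.1.exists_tail hz
  have hinj : Set.InjOn (fun z => (c₁ ++ f :: c₂).map some ++ₛ z) {x | R.Tail a x} :=
    fun z _ z' _ h => Stream'.append_right_injective _ _ _ h
  -- Prepending the cycle is an injective self-map of a finite set, hence onto. But the path that
  -- takes the exit after `c₁` does not begin with the cycle.
  rw [← Set.eq_of_subset_of_ncard_le hmaps.image_subset hinj.ncard_image.ge hfin]
    at hy
  obtain ⟨z, -, hz⟩ := hy
  dsimp only at hz
  simp only [List.map_append, List.map_cons, Stream'.append_append_stream,
    Stream'.append_right_inj, Stream'.cons_append_stream] at hz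
  have := congrArg Stream'.head hz
  rw [Stream'.head_cons, Stream'.head_cons] at this
  exact hef (Option.some_injective _ this).symm

/-- Under Condition (L), some maximal path starting at `a` avoids finitely many periods. -/
theorem CofinalRay.exists_tail_forall_ne (R : E.CofinalRay) (hL : E.ConditionL) (a : E.Vertex)
    (P : Finset (List E.Edge)) (hP : [] ∉ P) :
    ∃ x, R.Tail a x ∧ ∀ p ∈ P, x ≠ p.map some ++ₛ x := by
  by_contra! hcon
  obtain ⟨x, hx⟩ := R.exists_tail a
  obtain ⟨p, hpP, hp⟩ := hcon x hx
  have hp0 : p ≠ [] := fun h => hP (h ▸ hpP)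
  -- The path `p` leads from `a` to a start of `x`; both ends are the source of the first edge of
  -- `x`.
  have hpath : E.IsPath a p a := by
    obtain ⟨b, hab, hb⟩ := (hp ▸ hx : R.Tail a (p.map some ++ₛ x)).exists_of_append
    obtain ⟨e, q, rfl⟩ := List.exists_cons_of_ne_nil hp0
    have hhead : x.head = some e := by
      rw [hp]; rfl
    rw [← (hb.of_head_eq_some hhead).1, (hx.of_head_eq_some hhead).1] at hab
    exact hab
  obtain ⟨c, hc⟩ := exists_isCycle p hp0 hpath
  -- Each period in `P` admits at most one stream, so only finitely many maximal paths would start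
  -- at `a`.
  refine R.infinite_tail hL hc (Set.Finite.subset (s := ⋃ p ∈ P, {x | x = p.map some ++ₛ x})
    (P.finite_toSet.biUnion fun p hp => Set.Subsingleton.finite fun x hx y hy =>
      append_stream_inj_of_eq (fun h => hP (List.map_eq_nil_iff.1 h ▸ hp)) hx hy) fun x hx => ?_)
  obtain ⟨p, hp, hxp⟩ := hcon x hx
  exact Set.mem_biUnion hp hxp

/-! ### Construction of a cofinal ray -/

/-- A sink is a cofinal ray if all vertices connect to it. -/
def CofinalRay.ofSink {a : E.Vertex} (ha : E.IsSink a) (h : ∀ b, E.Connects b a) :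
    E.CofinalRay where
  vert _ := a
  edge _ := none
  step _ := .inr ⟨rfl, ha, rfl⟩
  cofinal b := ⟨0, h b⟩

/-- The stages of the construction of an infinite path through ever lower vertices: the next edge,
the edges after it up to an intermediate goal, and the number of goals already reached. -/
structure Stage (E : DirGraph.{u, v}) (g : ℕ → E.Vertex) where
  edge : E.Edge
  rest : List E.Edge
  goal : E.Vertex
  count : ℕ
  isPath : E.IsPath (E.r edge) rest goal
  connects : E.Connects (g count) goal

/-- Taking an edge before applying (MT3) guarantees progress even when the path to the goal has
length `0`. -/
theorem Stage.exists_start (hMT3 : E.ConditionMT3) (hsink : ∀ a, ¬ E.IsSink a) (g : ℕ → E.Vertex)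
    (a : E.Vertex) (n : ℕ) : ∃ t : E.Stage g, E.s t.edge = a ∧ t.count = n := by
  obtain ⟨e, he⟩ : ∃ e, E.s e = a := by simpa [IsSink] using hsink a
  obtain ⟨b, ⟨p, hp⟩, hb⟩ := hMT3 (E.r e) (g n)
  exact ⟨⟨e, p, b, n, hp, hb⟩, he, rfl⟩

theorem Stage.exists_next (hMT3 : E.ConditionMT3) (hsink : ∀ a, ¬ E.IsSink a) {g : ℕ → E.Vertex}
    (t : E.Stage g) : ∃ t' : E.Stage g, E.s t'.edge = E.r t.edge ∧
      ((t.rest = [] ∧ t'.count = t.count + 1) ∨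
        (t.rest = t'.edge :: t'.rest ∧ t'.goal = t.goal ∧ t'.count = t.count)) := by
  obtain ⟨e, p, b, n, hp, hb⟩ := t
  cases p with
  | nil =>
    obtain ⟨t', h, hn⟩ := exists_start hMT3 hsink g (E.r e) (n + 1)
    exact ⟨t', h, .inl ⟨rfl, hn⟩⟩
  | cons f p => exact ⟨⟨f, p, b, n, hp.tail, hb⟩, hp.source_eq, .inr ⟨rfl, rfl, rfl⟩⟩

theorem ConditionMT3.exists_cofinalRay_of_not_isSink (hMT3 : E.ConditionMT3)
    (hsink : ∀ a, ¬ E.IsSink a) [Nonempty E.Vertex] (g : ℕ → E.Vertex)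
    (hg : ∀ a, ∃ n, E.Connects a (g n)) : Nonempty E.CofinalRay := by
  choose next hnext using fun t : E.Stage g => t.exists_next hMT3 hsink
  obtain ⟨t₀, -, ht₀⟩ := Stage.exists_start hMT3 hsink g (Classical.arbitrary _) 0
  let t : ℕ → E.Stage g := fun n => next^[n] t₀
  have ht (n : ℕ) : t (n + 1) = next (t n) := Function.iterate_succ_apply' next n t₀
  -- Induction on the number of edges left: once they are used up, the ray stands at the goal and
  -- the next target is taken.
  have hgoal : ∀ (l : ℕ) (n : ℕ), (t n).rest.length = l →
      ∃ m, E.s (t m).edge = (t n).goal ∧ (t m).count = (t n).count + 1 := by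
    intro l
    induction l with
    | zero =>
      intro n hn
      have h := hnext (t n)
      rw [← ht] at h
      have hnil := List.eq_nil_of_length_eq_zero hn
      rcases h with ⟨hs, ⟨-, hc⟩ | ⟨hcons, -⟩⟩
      · refine ⟨n + 1, hs.trans ?_, hc⟩
        exact (hnil ▸ (t n).isPath).eq_of_nil
      · simp [hnil] at hcons
    | succ l ih =>
      intro n hn
      have h := hnext (t n)
      rw [← ht] at h
      rcases h with ⟨-, ⟨hnil, -⟩ | ⟨hcons, hgl, hc⟩⟩
      · simp [hnil] at hn
      · obtain ⟨m, hm⟩ := ih (n + 1) (by simpa [hcons] using hn)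
        exact ⟨m, hgl ▸ hc ▸ hm⟩
  have hcount : ∀ k, ∃ n, (t n).count = k := by
    intro k
    induction k with
    | zero => exact ⟨0, ht₀⟩
    | succ k ih =>
      obtain ⟨n, rfl⟩ := ih
      obtain ⟨m, -, hm⟩ := hgoal _ n rfl
      exact ⟨m, hm⟩
  refine ⟨⟨fun n => E.s (t n).edge, fun n => some (t n).edge,
    fun n => .inl ⟨_, rfl, rfl, ?_⟩, fun a => ?_⟩⟩
  · rw [ht]
    exact (hnext (t n)).1.symm
  · obtain ⟨k, hk⟩ := hg a
    obtain ⟨n, rfl⟩ := hcount k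
    obtain ⟨m, hm, -⟩ := hgoal _ n rfl
    -- The ray passes through a goal below `g k`, and `a` connects to `g k`.
    exact ⟨m, hm ▸ hk.trans (t n).connects⟩

theorem ConditionMT3.exists_cofinalRay (hMT3 : E.ConditionMT3) [Nonempty E.Vertex]
    (hCSP : E.HasCSP Set.univ) : Nonempty E.CofinalRay := by
  by_cases hsink : ∃ a, E.IsSink a
  · obtain ⟨a, ha⟩ := hsink
    -- A common lower bound of `b` and the sink can only be the sink.
    refine ⟨.ofSink ha fun b => ?_⟩
    obtain ⟨c, hac, hbc⟩ := hMT3 a b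
    exact ha.eq_of_connects hac ▸ hbc
  · push Not at hsink
    obtain ⟨C, hC, hsep⟩ := hCSP
    have hne : C.Nonempty := by
      obtain ⟨b, hb, -⟩ := hsep (Classical.arbitrary _) trivial
      exact ⟨b, hb⟩
    obtain ⟨g, rfl⟩ := hC.exists_eq_range hne
    refine hMT3.exists_cofinalRay_of_not_isSink hsink g fun a => ?_
    obtain ⟨_, ⟨n, rfl⟩, h⟩ := hsep a trivial
    exact ⟨n, h⟩

end DirGraph

/-! ### The filtration by the number of ghost edges -/

namespace LeavittPathAlgebra

open DirGraph

variable (K : Type w) [Field K] {E : DirGraph.{u, v}}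

/-- The element of the Leavitt path algebra given by a finite sequence of edges and the vertex at
which it ends. -/
noncomputable def pathElt (p : List E.Edge) (b : E.Vertex) : LeavittPathAlgebra K E :=
  p.foldr (fun e x => ed K e * x) (vx K b)

theorem pathElt_nil (b : E.Vertex) : pathElt K [] b = vx K b := rfl

theorem pathElt_cons (e : E.Edge) (p : List E.Edge) (b : E.Vertex) :
    pathElt K (e :: p) b = ed K e * pathElt K p b := rfl

theorem vx_mul_pathElt {a b : E.Vertex} {p : List E.Edge} (h : E.IsPath a p b) :
    vx K a * pathElt K p b = pathElt K p b := by
  cases h with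
  | nil => exact vx_mul_self K a
  | cons e h => rw [pathElt_cons, ← mul_assoc, vx_mul_ed]

theorem vx_mul_pathElt_of_ne {a b c : E.Vertex} {p : List E.Edge} (h : E.IsPath a p b)
    (hc : c ≠ a) : vx K c * pathElt K p b = 0 := by
  rw [← vx_mul_pathElt K h, ← mul_assoc, vx_mul_of_ne K hc, zero_mul]

theorem pathElt_mul_vx (p : List E.Edge) (b : E.Vertex) :
    pathElt K p b * vx K b = pathElt K p b := by
  induction p with
  | nil => exact vx_mul_self K b
  | cons e p ih => rw [pathElt_cons, mul_assoc, ih]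

theorem pathElt_mul_vx_of_ne (p : List E.Edge) {b c : E.Vertex} (h : b ≠ c) :
    pathElt K p b * vx K c = 0 := by
  rw [← pathElt_mul_vx, mul_assoc, vx_mul_of_ne K h, mul_zero]

theorem pathElt_mul_ed (p : List E.Edge) (e : E.Edge) :
    pathElt K p (E.s e) * ed K e = pathElt K (p ++ [e]) (E.r e) := by
  induction p with
  | nil => rw [pathElt_nil, vx_mul_ed, List.nil_append, pathElt_cons, pathElt_nil, ed_mul_vx]
  | cons f p ih => rw [pathElt_cons, mul_assoc, ih, List.cons_append, pathElt_cons]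

/-- The span of the paths ending at `b`. -/
noncomputable def pathSpan (b : E.Vertex) : Submodule K (LeavittPathAlgebra K E) :=
  Submodule.span K (Set.range fun p : {p : List E.Edge // ∃ a, E.IsPath a p b} => pathElt K p.1 b)

variable (E) in
/-- The span of the products of a path and at most `n` ghost edges, that is, of `p * q*` for
paths `p` and `q` with `q` of length at most `n`. -/
noncomputable def filt : ℕ → Submodule K (LeavittPathAlgebra K E)
  | 0 => ⨆ b, pathSpan K b
  | n + 1 => (⨆ b, pathSpan K b) ⊔ ⨆ e : E.Edge, (filt n).map (LinearMap.mulRight K (gh K e))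

variable {K}

theorem pathElt_mem_pathSpan {a b : E.Vertex} {p : List E.Edge} (h : E.IsPath a p b) :
    pathElt K p b ∈ pathSpan K b := Submodule.subset_span ⟨⟨p, a, h⟩, rfl⟩

theorem pathSpan_le_filt (b : E.Vertex) (n : ℕ) : pathSpan K b ≤ filt K E n := by
  cases n with
  | zero => exact le_iSup (pathSpan K) b
  | succ n => exact le_sup_of_le_left (le_iSup (pathSpan K) b)

theorem mul_gh_mem_filt {n : ℕ} {x : LeavittPathAlgebra K E} (hx : x ∈ filt K E n) (e : E.Edge) :
    x * gh K e ∈ filt K E (n + 1) :=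
  Submodule.mem_sup_right (Submodule.mem_iSup_of_mem e (Submodule.mem_map_of_mem hx))

theorem filt_le_iff {n : ℕ} {N : Submodule K (LeavittPathAlgebra K E)} :
    filt K E (n + 1) ≤ N ↔ (∀ b : E.Vertex, pathSpan K b ≤ N) ∧
      ∀ x ∈ filt K E n, ∀ e, x * gh K e ∈ N := by
  rw [filt, sup_le_iff, iSup_le_iff, iSup_le_iff]
  refine and_congr_right fun _ => ⟨fun h x hx e => h e (Submodule.mem_map_of_mem hx), fun h e => ?_⟩
  rintro _ ⟨x, hx, rfl⟩
  exact h x hx e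

theorem pathSpan_le_iff {b : E.Vertex} {N : Submodule K (LeavittPathAlgebra K E)} :
    pathSpan K b ≤ N ↔ ∀ a p, E.IsPath a p b → pathElt K p b ∈ N := by
  rw [pathSpan, Submodule.span_le, Set.range_subset_iff]
  exact ⟨fun h a p hp => h ⟨p, a, hp⟩, fun h ⟨p, a, hp⟩ => h a p hp⟩

theorem filt_le_succ (n : ℕ) : filt K E n ≤ filt K E (n + 1) := by
  induction n with
  | zero => exact iSup_le fun b => pathSpan_le_filt b 1
  | succ n ih =>
    exact filt_le_iff.2 ⟨fun b => pathSpan_le_filt b _, fun x hx e => mul_gh_mem_filt (ih hx) e⟩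

theorem filt_mono : Monotone (filt K E) := monotone_nat_of_le_succ filt_le_succ

/-- A linear map sends `filt n` into `N` if it sends the spanning elements into `N`. -/
theorem filt_le_comap {n : ℕ} {N : Submodule K (LeavittPathAlgebra K E)}
    {f : LeavittPathAlgebra K E →ₗ[K] LeavittPathAlgebra K E}
    (h₁ : ∀ a b p, E.IsPath a p b → f (pathElt K p b) ∈ N)
    (h₂ : ∀ m < n, ∀ x ∈ filt K E m, ∀ e, f (x * gh K e) ∈ N) : filt K E n ≤ N.comap f := by
  have h (b : E.Vertex) : pathSpan K b ≤ N.comap f := pathSpan_le_iff.2 fun a p hp => h₁ a b p hp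
  cases n with
  | zero => exact iSup_le h
  | succ n => exact filt_le_iff.2 ⟨h, h₂ n n.lt_succ_self⟩

theorem mul_vx_mem_pathSpan {x : LeavittPathAlgebra K E} (hx : x ∈ filt K E 0) (b : E.Vertex) :
    x * vx K b ∈ pathSpan K b := by
  refine filt_le_comap (N := pathSpan K b)
    (f := LinearMap.mulRight K (vx K b)) (fun a c p hp => ?_) (by simp) hx
  rw [LinearMap.mulRight_apply]
  by_cases h : c = b
  · subst h
    rw [pathElt_mul_vx]
    exact pathElt_mem_pathSpan hp
  · rw [pathElt_mul_vx_of_ne K p h]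
    exact zero_mem _

theorem mul_vx_mem_filt {n : ℕ} {x : LeavittPathAlgebra K E} (hx : x ∈ filt K E n)
    (b : E.Vertex) : x * vx K b ∈ filt K E n := by
  refine filt_le_comap (f := LinearMap.mulRight K (vx K b)) (fun a c p hp => ?_)
    (fun m hm y hy e => ?_) hx
  · exact pathSpan_le_filt b n (mul_vx_mem_pathSpan
      (pathSpan_le_filt c 0 (pathElt_mem_pathSpan hp)) b)
  · rw [LinearMap.mulRight_apply, mul_assoc]
    by_cases h : E.s e = b
    · subst h
      rw [gh_mul_vx]
      exact filt_mono hm (mul_gh_mem_filt hy e)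
    · rw [gh_mul_vx_of_ne K h, mul_zero]
      exact zero_mem _

/-- By (CK1) the real edge cancels the last ghost edge, or else kills the term; without ghost edges
it extends the path or kills it. This drives the induction for faithfulness. -/
theorem mul_ed_mem_filt {n : ℕ} {x : LeavittPathAlgebra K E} (hx : x ∈ filt K E (n + 1))
    (e : E.Edge) : x * ed K e ∈ filt K E n := by
  refine filt_le_comap (f := LinearMap.mulRight K (ed K e)) (fun a c p hp => ?_)
    (fun m hm y hy f => ?_) hx
  · rw [LinearMap.mulRight_apply]
    by_cases h : E.s e = c
    · subst h
      rw [pathElt_mul_ed]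
      exact pathSpan_le_filt _ _ (pathElt_mem_pathSpan (hp.append (.cons e (.nil _))))
    · rw [← pathElt_mul_vx, mul_assoc, vx_mul_ed_of_ne K (Ne.symm h), mul_zero]
      exact zero_mem _
  · rw [LinearMap.mulRight_apply, mul_assoc]
    by_cases h : f = e
    · subst h
      rw [gh_mul_ed_self]
      exact filt_mono (Nat.le_of_lt_succ hm) (mul_vx_mem_filt hy _)
    · rw [gh_mul_ed_of_ne K h, mul_zero]
      exact zero_mem _

theorem vx_mul_mem_filt {n : ℕ} {x : LeavittPathAlgebra K E} (hx : x ∈ filt K E n)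
    (b : E.Vertex) : vx K b * x ∈ filt K E n := by
  induction n using Nat.strong_induction_on generalizing x with
  | _ n ih =>
  refine filt_le_comap (f := LinearMap.mulLeft K (vx K b)) (fun a c p hp => ?_)
    (fun m hm y hy e => ?_) hx
  · rw [LinearMap.mulLeft_apply]
    by_cases h : b = a
    · subst h
      rw [vx_mul_pathElt K hp]
      exact pathSpan_le_filt c n (pathElt_mem_pathSpan hp)
    · rw [vx_mul_pathElt_of_ne K hp h]
      exact zero_mem _
  · rw [LinearMap.mulLeft_apply, ← mul_assoc]
    exact filt_mono hm (mul_gh_mem_filt (ih m hm hy) e)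

theorem ed_mul_mem_filt {n : ℕ} {x : LeavittPathAlgebra K E} (hx : x ∈ filt K E n)
    (e : E.Edge) : ed K e * x ∈ filt K E n := by
  induction n using Nat.strong_induction_on generalizing x with
  | _ n ih =>
  refine filt_le_comap (f := LinearMap.mulLeft K (ed K e)) (fun a c p hp => ?_)
    (fun m hm y hy f => ?_) hx
  · rw [LinearMap.mulLeft_apply]
    by_cases h : E.r e = a
    · subst h
      exact pathSpan_le_filt c n (pathElt_mem_pathSpan (.cons e hp))
    · rw [← vx_mul_pathElt K hp, ← mul_assoc, ed_mul_vx_of_ne K h, zero_mul]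
      exact zero_mem _
  · rw [LinearMap.mulLeft_apply, ← mul_assoc]
    exact filt_mono hm (mul_gh_mem_filt (ih m hm hy) f)

theorem gh_mul_mem_filt {n : ℕ} {x : LeavittPathAlgebra K E} (hx : x ∈ filt K E n)
    (e : E.Edge) : gh K e * x ∈ filt K E (n + 1) := by
  induction n using Nat.strong_induction_on generalizing x with
  | _ n ih =>
  refine filt_le_comap (N := filt K E (n + 1))
    (f := LinearMap.mulLeft K (gh K e)) (fun a c p hp => ?_)
    (fun m hm y hy f => ?_) hx
  · rw [LinearMap.mulLeft_apply]
    cases hp with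
    | nil =>
      rw [pathElt_nil]
      by_cases h : E.s e = a
      · subst h
        rw [gh_mul_vx, ← vx_mul_gh]
        exact mul_gh_mem_filt (pathSpan_le_filt _ n (pathElt_mem_pathSpan (.nil _))) e
      · rw [gh_mul_vx_of_ne K h]
        exact zero_mem _
    | cons f hp =>
      rw [pathElt_cons, ← mul_assoc]
      by_cases h : e = f
      · subst h
        rw [gh_mul_ed_self, vx_mul_pathElt K hp]
        exact pathSpan_le_filt _ _ (pathElt_mem_pathSpan hp)
      · rw [gh_mul_ed_of_ne K h, zero_mul]
        exact zero_mem _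
  · rw [LinearMap.mulLeft_apply, ← mul_assoc]
    exact filt_mono (Nat.succ_le_succ hm) (mul_gh_mem_filt (ih m hm hy) f)

theorem exists_mem_filt (x : LeavittPathAlgebra K E) : ∃ n, x ∈ filt K E n := by
  -- Closure under left multiplication is carried along, since products need it in the induction.
  suffices h : (∃ n, x ∈ filt K E n) ∧ ∀ m, ∀ y ∈ filt K E m, ∃ n, x * y ∈ filt K E n from h.1
  induction x using induction_on with
  | vx a =>
    exact ⟨⟨0, pathSpan_le_filt a 0 (pathElt_mem_pathSpan (.nil a))⟩,
      fun m y hy => ⟨m, vx_mul_mem_filt hy a⟩⟩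
  | ed e =>
    refine ⟨⟨0, ?_⟩, fun m y hy => ⟨m, ed_mul_mem_filt hy e⟩⟩
    have := pathSpan_le_filt (K := K) _ 0 (pathElt_mem_pathSpan (.cons e (.nil _)))
    rwa [pathElt_cons, pathElt_nil, ed_mul_vx] at this
  | gh e =>
    refine ⟨⟨1, ?_⟩, fun m y hy => ⟨m + 1, gh_mul_mem_filt hy e⟩⟩
    rw [← vx_mul_gh]
    exact mul_gh_mem_filt (pathSpan_le_filt _ 0 (pathElt_mem_pathSpan (.nil _))) e
  | zero => exact ⟨⟨0, zero_mem _⟩, fun m y _ => ⟨0, by rw [zero_mul]; exact zero_mem _⟩⟩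
  | add x y hx hy =>
    have key : ∀ {a b : LeavittPathAlgebra K E}, (∃ n, a ∈ filt K E n) → (∃ n, b ∈ filt K E n) →
        ∃ n, a + b ∈ filt K E n := by
      rintro a b ⟨m, ha⟩ ⟨n, hb⟩
      exact ⟨max m n, add_mem (filt_mono (le_max_left m n) ha) (filt_mono (le_max_right m n) hb)⟩
    exact ⟨key hx.1 hy.1, fun m z hz => by rw [add_mul]; exact key (hx.2 m z hz) (hy.2 m z hz)⟩
  | mul x y hx hy =>
    refine ⟨?_, fun m z hz => ?_⟩
    · obtain ⟨n, hn⟩ := hy.1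
      exact hx.2 n y hn
    · obtain ⟨n, hn⟩ := hy.2 m z hz
      rw [mul_assoc]
      exact hx.2 n _ hn
  | smul k x hx =>
    refine ⟨?_, fun m z hz => ?_⟩
    · obtain ⟨n, hn⟩ := hx.1
      exact ⟨n, Submodule.smul_mem _ k hn⟩
    · obtain ⟨n, hn⟩ := hx.2 m z hz
      exact ⟨n, by rw [smul_mul_assoc]; exact Submodule.smul_mem _ k hn⟩

theorem exists_eq_add_sum {n : ℕ} {x : LeavittPathAlgebra K E} (hx : x ∈ filt K E (n + 1)) :
    ∃ p ∈ filt K E 0, ∃ (F : Finset E.Edge) (y : E.Edge → LeavittPathAlgebra K E),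
      (∀ e, y e ∈ filt K E n) ∧ x = p + ∑ e ∈ F, y e * gh K e := by
  obtain ⟨p, hp, z, hz, rfl⟩ := Submodule.mem_sup.1 hx
  refine ⟨p, hp, ?_⟩
  let f : (E.Edge →₀ filt K E n) →ₗ[K] LeavittPathAlgebra K E :=
    Finsupp.lsum K fun e => LinearMap.mulRight K (gh K e) ∘ₗ (filt K E n).subtype
  have hle : (⨆ e : E.Edge, (filt K E n).map (LinearMap.mulRight K (gh K e))) ≤
      LinearMap.range f := by
    refine iSup_le fun e => ?_
    rintro _ ⟨y, hy, rfl⟩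
    exact ⟨Finsupp.single e ⟨y, hy⟩, by simp [f]⟩
  obtain ⟨c, rfl⟩ := hle hz
  exact ⟨c.support, fun e => c e, fun e => (c e).2, rfl⟩

/-- Finite sums of vertices are local units; allowing every larger `G` lets two summands share one.
-/
theorem exists_mul_sum_vx_eq (x : LeavittPathAlgebra K E) :
    ∃ F : Finset E.Vertex, ∀ G, F ⊆ G → x * ∑ a ∈ G, vx K a = x := by
  classical
  have key (x : LeavittPathAlgebra K E) (b : E.Vertex) (h : x * vx K b = x) :
      ∃ F : Finset E.Vertex, ∀ G, F ⊆ G → x * ∑ a ∈ G, vx K a = x := by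
    refine ⟨{b}, fun G hG => ?_⟩
    rw [← h, mul_assoc, Finset.mul_sum, Finset.sum_eq_single_of_mem b (hG (by simp)),
      vx_mul_self]
    intro a _ hab
    exact vx_mul_of_ne K hab.symm
  induction x using induction_on with
  | vx a => exact key _ a (vx_mul_self K a)
  | ed e => exact key _ _ (ed_mul_vx K e)
  | gh e => exact key _ _ (gh_mul_vx K e)
  | zero => exact ⟨∅, fun G _ => zero_mul _⟩
  | add x y hx hy =>
    obtain ⟨F₁, h₁⟩ := hx
    obtain ⟨F₂, h₂⟩ := hy
    refine ⟨F₁ ∪ F₂, fun G hG => ?_⟩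
    rw [add_mul, h₁ G (Finset.union_subset_left hG), h₂ G (Finset.union_subset_right hG)]
  | mul x y hx hy =>
    obtain ⟨F, h⟩ := hy
    exact ⟨F, fun G hG => by rw [mul_assoc, h G hG]⟩
  | smul k x hx =>
    obtain ⟨F, h⟩ := hx
    exact ⟨F, fun G hG => by rw [smul_mul_assoc, h G hG]⟩

theorem eq_zero_of_mul_vx_eq_zero {x : LeavittPathAlgebra K E} (h : ∀ a, x * vx K a = 0) :
    x = 0 := by
  obtain ⟨F, hF⟩ := exists_mul_sum_vx_eq x
  rw [← hF F subset_rfl, Finset.mul_sum]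
  exact Finset.sum_eq_zero fun a _ => h a

end LeavittPathAlgebra

/-! ### Faithfulness of the module -/

namespace DirGraph

open LeavittPathAlgebra

variable {K : Type w} [Field K] {E : DirGraph.{u, v}} {R : E.CofinalRay}

theorem CofinalRay.rep_pathElt_single {a b : E.Vertex} {p : List E.Edge} (hp : E.IsPath a p b)
    {x : Stream' (Option E.Edge)} (hx : R.Tail b x) (k : K) :
    R.rep K (pathElt K p b) (Finsupp.single ⟨(b, x), hx⟩ k) =
      Finsupp.single ⟨(a, p.map some ++ₛ x), hp.exists_tail hx⟩ k := by
  induction hp with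
  | nil a => exact R.rep_vx_single a ⟨(a, x), hx⟩ k rfl
  | cons e h ih =>
    rw [pathElt_cons, map_mul, Module.End.mul_apply, ih hx]
    exact R.rep_ed_single e _ k rfl

/-- A combination of paths ending at `b` is zero if it annihilates sufficiently many of the maximal
paths starting at `b`. -/
theorem CofinalRay.eq_zero_of_mem_pathSpan {b : E.Vertex} {z : LeavittPathAlgebra K E}
    (hz : z ∈ pathSpan K b) (T : Set (Stream' (Option E.Edge)))
    (hT : ∀ P : Finset (List E.Edge), [] ∉ P →
      ∃ x ∈ T, R.Tail b x ∧ ∀ p ∈ P, x ≠ p.map some ++ₛ x)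
    (h : ∀ x (hx : R.Tail b x), x ∈ T → R.rep K z (Finsupp.single ⟨(b, x), hx⟩ 1) = 0) :
    z = 0 := by
  classical
  obtain ⟨c, rfl⟩ := Finsupp.mem_span_range_iff_exists_finsupp.1 hz
  suffices hc : c = 0 by rw [hc, Finsupp.sum_zero_index]
  by_contra hc
  obtain ⟨q, hq, hmin⟩ := c.support.exists_min_image (fun p => p.1.length)
    (Finsupp.support_nonempty_iff.2 hc)
  -- The coefficient of the shortest path `q` is read off at `q x`. If also `p x = q x`, then `p = q
  -- d` and `x = d x`; the nonempty `d` are the periods to avoid.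
  obtain ⟨x, hxT, hx, hne⟩ := hT ((c.support.image fun p => p.1.drop q.1.length).erase [])
    (Finset.notMem_erase _ _)
  choose src hsrc using fun p : {p : List E.Edge // ∃ a, E.IsPath a p b} => p.2
  have h0 := DFunLike.congr_fun (h x hx hxT) ⟨(src q, q.1.map some ++ₛ x), (hsrc q).exists_tail hx⟩
  rw [Finsupp.sum, map_sum, LinearMap.sum_apply, Finsupp.finsetSum_apply,
    Finset.sum_eq_single_of_mem q hq] at h0
  · rw [map_smul, LinearMap.smul_apply, R.rep_pathElt_single (hsrc q) hx] at h0
    simp at h0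
    exact Finsupp.mem_support_iff.1 hq h0
  · intro p hp hpq
    rw [map_smul, LinearMap.smul_apply, R.rep_pathElt_single (hsrc p) hx, Finsupp.smul_apply,
      Finsupp.single_apply, if_neg, smul_zero]
    intro heq
    have hstr : p.1.map some ++ₛ x = q.1.map some ++ₛ x := congrArg (fun y => y.1.2) heq
    rw [← List.take_append_drop q.1.length p.1, List.map_append,
      Stream'.append_append_stream] at hstr
    have htake : p.1.take q.1.length = q.1 := by
      refine List.map_injective_iff.2 (Option.some_injective _)
        (Stream'.append_left_injective _ _ _ _ hstr ?_)
      simpa using hmin p hp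
    rw [htake, Stream'.append_right_inj] at hstr
    by_cases hdrop : p.1.drop q.1.length = []
    · refine hpq (Subtype.ext ?_)
      rw [← List.take_append_drop q.1.length p.1, htake, hdrop, List.append_nil]
    · exact hne _ (Finset.mem_erase.2 ⟨hdrop, Finset.mem_image_of_mem _ hp⟩) hstr.symm

/-- Right multiplication by an edge lowers the filtration and keeps `x` in the kernel, so it gives
zero; it remains to recover `x b` from the products `x e`. -/
theorem CofinalRay.eq_zero_of_rep_eq_zero (R : E.CofinalRay) (hL : E.ConditionL) (n : ℕ)
    (x : LeavittPathAlgebra K E) (hx : x ∈ filt K E n) (h : R.rep K x = 0) : x = 0 := by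
  classical
  induction n generalizing x with
  | zero =>
    refine eq_zero_of_mul_vx_eq_zero fun b => R.eq_zero_of_mem_pathSpan
      (mul_vx_mem_pathSpan hx b) Set.univ (fun P hP => ?_) (fun y hy _ => ?_)
    · obtain ⟨y, hy⟩ := R.exists_tail_forall_ne hL b P hP
      exact ⟨y, trivial, hy⟩
    · rw [map_mul, h, zero_mul, LinearMap.zero_apply]
  | succ n ih =>
    have hed (e : E.Edge) : x * ed K e = 0 :=
      ih _ (mul_ed_mem_filt hx e) (by rw [map_mul, h, zero_mul])
    refine eq_zero_of_mul_vx_eq_zero fun b => ?_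
    by_cases hreg : {e : E.Edge | E.s e = b}.Finite ∧ {e : E.Edge | E.s e = b}.Nonempty
    · rw [vx_eq_sum K b hreg.1 hreg.2, Finset.mul_sum]
      exact Finset.sum_eq_zero fun e _ => by rw [← mul_assoc, hed, zero_mul]
    · obtain ⟨p, hp, F, y, -, rfl⟩ := exists_eq_add_sum hx
      -- On maximal paths whose first edge is not in `F` the ghost terms vanish, so `p` alone acts
      -- as zero.
      have hpb : p * vx K b = 0 := by
        refine R.eq_zero_of_mem_pathSpan (mul_vx_mem_pathSpan hp b)
          {z | ∀ e ∈ F, z.head ≠ some e} (fun P hP => ?_) (fun z hz hzF => ?_)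
        · by_cases hinf : {e : E.Edge | E.s e = b}.Finite
          -- Emitting finitely many edges without being regular means emitting none; the trivial
          -- maximal path has no period.
          · have hsink : E.IsSink b := fun e he => hreg ⟨hinf, e, he⟩
            obtain ⟨z, hz⟩ := R.exists_tail b
            have hz0 := hz.eq_const_of_isSink hsink
            refine ⟨z, fun e _ => by simp [hz0], hz, fun q hq hzq => ?_⟩
            obtain ⟨e, r, rfl⟩ := List.exists_cons_of_ne_nil fun h0 : q = [] => hP (h0 ▸ hq)
            have := congrArg Stream'.head hzq
            rw [hz0] at this
            cases this
          -- An infinite emitter has an edge outside `F` that also differs from the first edge of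
          -- every period.
          · obtain ⟨f, hf, hfF⟩ := Set.Infinite.exists_notMem_finset hinf
              (F ∪ P.biUnion fun q => q.head?.toFinset)
            rw [Finset.mem_union, not_or] at hfF
            obtain ⟨z, hz⟩ := R.exists_tail (E.r f)
            refine ⟨Stream'.cons (some f) z, fun e he hfe => ?_, hf ▸ .cons f hz,
              fun q hq hzq => ?_⟩
            · obtain rfl : f = e := Option.some_injective _ hfe
              exact hfF.1 he
            · obtain ⟨e, r, rfl⟩ := List.exists_cons_of_ne_nil fun h0 : q = [] => hP (h0 ▸ hq)
              obtain rfl : f = e := Option.some_injective _ (congrArg Stream'.head hzq)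
              exact hfF.2 (Finset.mem_biUnion.2 ⟨_, hq, by simp⟩)
        · have h' := DFunLike.congr_fun h (Finsupp.single ⟨(b, z), hz⟩ 1)
          rw [map_add, LinearMap.add_apply, map_sum, LinearMap.sum_apply, Finset.sum_eq_zero,
            add_zero] at h'
          · rw [map_mul, Module.End.mul_apply, R.rep_vx_single b _ _ rfl, h']
            rfl
          · intro e he
            rw [map_mul, Module.End.mul_apply, R.rep_gh_single_of_ne e _ _ (hzF e he), map_zero]
      rw [add_mul, hpb, zero_add, Finset.sum_mul]
      refine Finset.sum_eq_zero fun e he => ?_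
      rw [mul_assoc]
      by_cases hs : E.s e = b
      · subst hs
        -- As `p e = p s(e) e = 0`, (CK1) turns `x e = 0` into `y e * r(e) = 0`, which kills `y e *
        -- e*`.
        have h' := hed e
        rw [add_mul, ← vx_mul_ed, ← mul_assoc, hpb, zero_mul, zero_add, vx_mul_ed, Finset.sum_mul,
          Finset.sum_eq_single_of_mem e he, mul_assoc, gh_mul_ed_self] at h'
        · rw [gh_mul_vx, ← vx_mul_gh, ← mul_assoc, h', zero_mul]
        · intro f _ hf
          rw [mul_assoc, gh_mul_ed_of_ne K hf, mul_zero]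
      · rw [gh_mul_vx_of_ne K hs, mul_zero]

theorem CofinalRay.isFaithful (R : E.CofinalRay) (hL : E.ConditionL) :
    IsFaithfulLeftModule (R.repEnd K) := by
  intro x hx
  obtain ⟨n, hn⟩ := exists_mem_filt x
  exact R.eq_zero_of_rep_eq_zero hL n x hn (LinearMap.ext hx)

end DirGraph

theorem mainTheorem4 (K : Type w) [Field K] (E : DirGraph.{u, v}) [Nonempty E.Vertex]
    (hMT3 : E.ConditionMT3) (hL : E.ConditionL) (hCSP : E.HasCSP Set.univ) :
    IsLeftPrimitiveRing (LeavittPathAlgebra K E) ∧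
      IsRightPrimitiveRing (LeavittPathAlgebra K E) := by
  obtain ⟨R⟩ := hMT3.exists_cofinalRay hCSP
  have h : IsLeftPrimitiveRing (LeavittPathAlgebra K E) :=
    ⟨R.Point →₀ K, inferInstance, R.repEnd K, R.isSimple, R.isFaithful hL⟩
  exact ⟨h, h.of_ringEquiv (LeavittPathAlgebra.starEquiv K E)⟩
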